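/- Let $(\Omega,\mathcal A,P)$ be a probability space and $(X_t)_{t\ge 1}$ a process with values in $[0,1]$ that is weakly stationary: $\mu=E[X_t]$ does not depend on $t$ and $\mathrm{Cov}(X_t,X_{t+h})$ depends only on $h$. Let $C(\cdot)$ be a semi-norm on a linear space $\mathcal C$ of bounded Borel functions $[0,1]\to\mathbb R$, put $\mathcal C_1=\{f\in\mathcal C: C(f)\le 1\}$, and assume that the identity function $x\mapsto x$ belongs to $\mathcal C_1$. With $\mathcal F_i=\sigma(X_1,\dots,X_i)$, define for $k\in\mathbb N$ $$\Phi_{\mathcal C}(k)=\sup_{\varphi\in\mathcal C_1,\ i\ge 1}\bigl\|E[\varphi(X_{i+k})\mid\mathcal F_i]-E[\varphi(X_{i+k})]\bigr\|_{L^\infty(P)}\in[0,\infty],$$ and assume that the process is $\mathcal C$-mixing, i.e. $\Phi_{\mathcal C}(k)\to 0$ as $k\to\infty$. Let $A=4\sqrt e$. Then for every $n\ge 1$ and every $\delta\in(0,1)$, with probability at least $1-\delta$, $$\Bigl|\frac1n\sum_{t=1}^n X_t-\mu\Bigr|\le\Bigl(1+80\sum_{j=1}^n j^{-3/2}\sum_{k=1}^j\Phi_{\mathcal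 C}(k)\Bigr)\sqrt{\frac{2\log(A/\delta)}{n}}.$$ Moreover, for every $n\ge 1$, every $\delta\in(0,1)$ and every fixed gap $k\ge 1$, with probability at least $1-\delta$, $$\Bigl|\frac1n\sum_{t=1}^n X_{kt}-\mu\Bigr|\le\Bigl(1+80\sum_{j=1}^n j^{-3/2}\sum_{\ell=1}^j\Phi_{\mathcal C}(k\ell)\Bigr)\sqrt{\frac{2\log(A/\delta)}{n}}.$$ -/

import Mathlib

open MeasureTheory ProbabilityTheory
open scoped ENNReal

namespace WeakMixing

/-- A semi-norm `C` on a linear space of bounded (Borel measurable) functions `[0,1] → ℝ`. -/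
structure TestClass where
  /-- the function space -/
  space : Submodule ℝ (unitInterval → ℝ)
  bounded : ∀ f ∈ space, ∃ M : ℝ, ∀ x, |f x| ≤ M
  measurable : ∀ f ∈ space, Measurable f
  /-- the semi-norm -/
  C : Seminorm ℝ space

/-- The semi-norm unit ball: all `f` in the space with `C(f) ≤ 1`. -/
def TestClass.unitBall (𝒞 : TestClass) : Set (unitInterval → ℝ) :=
  {f | ∃ h : f ∈ 𝒞.space, 𝒞.C ⟨f, h⟩ ≤ 1}

variable {Ω : Type*} [MeasurableSpace Ω]

/-- The sigma-algebra `ℱ_i` generated by `X_1, …, X_i`. Processes are indexed by `t ≥ 1`;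
the value at index `0` is never used. -/
abbrev past (X : ℕ → Ω → unitInterval) (i : ℕ) : MeasurableSpace Ω :=
  ⨆ j ∈ Set.Icc 1 i, MeasurableSpace.comap (X j) inferInstance

/-- Weak stationarity of `(X_t)_{t ≥ 1}`: the mean does not depend on time and the covariance
depends only on the time lag. -/
structure IsWeaklyStationary (X : ℕ → Ω → unitInterval) (P : Measure Ω) : Prop where
  mean_eq : ∀ s t : ℕ, 1 ≤ s → 1 ≤ t →
    ∫ ω, (X s ω : ℝ) ∂P = ∫ ω, (X t ω : ℝ) ∂P
  cov_eq : ∀ s t h : ℕ, 1 ≤ s → 1 ≤ t →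
    covariance (fun ω => (X s ω : ℝ)) (fun ω => (X (s + h) ω : ℝ)) P =
      covariance (fun ω => (X t ω : ℝ)) (fun ω => (X (t + h) ω : ℝ)) P

/-- The mixing coefficient: the supremum over `φ` in the unit ball and `i ≥ 1` of the
`L^∞` norm of `E[φ(X_{i+k}) | ℱ_i] - E[φ(X_{i+k})]`, as an extended nonnegative real. -/
noncomputable def mixingCoeff (𝒞 : TestClass) (X : ℕ → Ω → unitInterval) (P : Measure Ω)
    (k : ℕ) : ℝ≥0∞ :=
  ⨆ φ ∈ 𝒞.unitBall, ⨆ i : ℕ, ⨆ _ : 1 ≤ i,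
    eLpNorm (fun ω => (P[fun ω' => φ (X (i + k) ω') | past X i]) ω
      - ∫ ω', φ (X (i + k) ω') ∂P) ∞ P

/-- The process is weakly mixing with respect to `𝒞`: its mixing coefficients tend to zero. -/
def IsMixing (𝒞 : TestClass) (X : ℕ → Ω → unitInterval) (P : Measure Ω) : Prop :=
  Filter.Tendsto (mixingCoeff 𝒞 X P) Filter.atTop (nhds 0)

end WeakMixing

/-!
The proof combines a dyadic martingale decomposition with the Azuma–Hoeffding inequality, in the
form of sub-Gaussian bounds on moment generating functions.

Write `Z` for the centred process observed up to time `n`, extended by zero, and `ℱ` for its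
filtration. Subtracting from each `Z i` its one-step prediction gives martingale differences bounded
by `1`, with sub-Gaussian parameter `√n`. What remains is a sum of predictions of blocks of length
`1`. For a block length `m`, let `predictedSum` be the sum over consecutive blocks of the conditional
expectation of the block sum given the past of the block. Passing from length `2 * m` to length `m`
only updates the prediction of the second half of each long block, so the change is a sum of
martingale differences along the coarser filtration (`predictedSum_two_mul`). Each difference is
bounded by `2 * Δ m`, where `Δ m` is the sum of the first `m` mixing coefficients, and there are
about `n / (2 * m)` of them; the sub-Gaussian parameter of the change is therefore at most
`2 * √(n / m) * Δ m` (`hasSubgaussianMGF_sum_update`). At the coarsest scale there is a single block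
predicted from the trivial σ-algebra, and its prediction is zero.

Sub-Gaussian parameters are subadditive without independence, so they may be summed over the scales
`m = 2 ^ i`. Since the mixing coefficients are nonincreasing in the lag (`mixingCoeff_antitone`),
`Δ (2 * m) ≤ 2 * Δ m`, and the sum over dyadic scales is at most a constant times
`∑ j, j ^ (-3/2) * Δ j` (`sum_dyadic_le`). This yields the parameter
`√n * (1 + 8 * ∑ j, j ^ (-3/2) * Δ j)` (`hasSubgaussianMGF_sum_range`), and the Chernoff bound
finishes the proof.

The test function relevant to the mean is the identity. The one-step inequality behind
Azuma–Hoeffding (`HasSubgaussianMGF.add_of_condExp_eq_zero`) is proved from convexity of the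
exponential, because the underlying probability space need not be standard Borel.
-/

namespace WeakMixing

open scoped NNReal

/-! ### Sub-Gaussian sums of bounded martingale differences -/

section Hoeffding

variable {Ω : Type*} {mΩ : MeasurableSpace Ω} {P : Measure Ω}

/-- Minkowski's inequality for the square roots of the variance proxies; no independence is
assumed. -/
lemma _root_.ProbabilityTheory.HasSubgaussianMGF.add_sq {X Y : Ω → ℝ} {σ τ : ℝ≥0}
    (hX : HasSubgaussianMGF X (σ ^ 2) P) (hY : HasSubgaussianMGF Y (τ ^ 2) P) :
    HasSubgaussianMGF (fun ω => X ω + Y ω) ((σ + τ) ^ 2) P := by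
  simpa using hX.add hY

/-- One step of the Azuma–Hoeffding argument. Convexity gives
`exp (t * D) ≤ cosh (t * c) + D / c * sinh (t * c)`, and the second term integrates to zero against
any `m`-measurable weight, so no regular conditional distribution is needed. -/
lemma _root_.ProbabilityTheory.HasSubgaussianMGF.add_of_condExp_eq_zero [IsProbabilityMeasure P]
    {m : MeasurableSpace Ω} (hm : m ≤ mΩ) {S D : Ω → ℝ} {v c : ℝ≥0}
    (hSm : StronglyMeasurable[m] S) (hS : HasSubgaussianMGF S v P)
    (hDm : AEStronglyMeasurable[mΩ] D P) (hD : ∀ᵐ ω ∂P, |D ω| ≤ c) (hD0 : P[D | m] =ᵐ[P] 0) :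
    HasSubgaussianMGF (fun ω => S ω + D ω) (v + c ^ 2) P := by
  rcases eq_or_ne c 0 with rfl | hc
  · have : S =ᵐ[P] fun ω => S ω + D ω := by
      filter_upwards [hD] with ω h
      simp only [NNReal.coe_zero, abs_nonpos_iff] at h
      simp [h]
    simpa using hS.congr this
  have hc' : (0 : ℝ) < c := by positivity
  have hDint : Integrable D P := .of_bound hDm c hD
  have hexpm : ∀ t : ℝ, StronglyMeasurable[m] fun ω => Real.exp (t * S ω) := fun t =>
    Real.continuous_exp.comp_stronglyMeasurable (hSm.const_mul t)
  have hED : ∀ t : ℝ, Integrable (fun ω => Real.exp (t * S ω) * D ω) P := fun t =>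
    (hS.integrable_exp_mul t).mul_bdd hDm hD
  have hED0 : ∀ t : ℝ, ∫ ω, Real.exp (t * S ω) * D ω ∂P = 0 := by
    intro t
    have h := condExp_mul_of_stronglyMeasurable_left (hexpm t) (hED t) hDint
    rw [← integral_condExp hm]
    refine (integral_congr_ae (h.trans (hD0.mono fun ω hω => ?_))
      (g := fun _ => (0 : ℝ))).trans (by simp)
    simp [hω]
  have hle : ∀ t : ℝ, ∀ᵐ ω ∂P, Real.exp (t * (S ω + D ω)) ≤
      Real.cosh (t * c) * Real.exp (t * S ω)
        + Real.sinh (t * c) / c * (Real.exp (t * S ω) * D ω) := by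
    intro t
    filter_upwards [hD] with ω hω
    have h1 : |D ω / c| ≤ 1 := by
      rw [abs_div, abs_of_pos hc', div_le_one hc']; exact hω
    have h2 := Real.exp_mul_le_cosh_add_mul_sinh h1 (t * c)
    have h3 : D ω / c * (t * c) = t * D ω := by field_simp
    rw [h3] at h2
    calc Real.exp (t * (S ω + D ω)) = Real.exp (t * S ω) * Real.exp (t * D ω) := by
          rw [← Real.exp_add]; ring_nf
      _ ≤ Real.exp (t * S ω) * (Real.cosh (t * c) + D ω / c * Real.sinh (t * c)) := by gcongr
      _ = _ := by ring
  have hint : ∀ t : ℝ, Integrable (fun ω => Real.cosh (t * c) * Real.exp (t * S ω)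
        + Real.sinh (t * c) / c * (Real.exp (t * S ω) * D ω)) P := fun t =>
    ((hS.integrable_exp_mul t).const_mul _).add ((hED t).const_mul _)
  have hexp : ∀ t : ℝ, Integrable (fun ω => Real.exp (t * (S ω + D ω))) P := by
    intro t
    refine (hint t).mono ?_ ?_
    · exact Real.continuous_exp.comp_aestronglyMeasurable
        (((hSm.mono hm).aestronglyMeasurable.add hDm).const_mul t)
    · filter_upwards [hle t] with ω hω
      rw [Real.norm_of_nonneg (Real.exp_pos _).le]
      exact hω.trans (le_abs_self _)
  refine ⟨hexp, fun t => ?_⟩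
  calc mgf (fun ω => S ω + D ω) P t
      ≤ ∫ ω, (Real.cosh (t * c) * Real.exp (t * S ω)
        + Real.sinh (t * c) / c * (Real.exp (t * S ω) * D ω)) ∂P :=
        integral_mono_ae (hexp t) (hint t) (hle t)
    _ = Real.cosh (t * c) * mgf S P t := by
        rw [integral_add ((hS.integrable_exp_mul t).const_mul _) ((hED t).const_mul _),
          integral_const_mul, integral_const_mul, hED0, mul_zero, add_zero, mgf]
    _ ≤ Real.exp ((t * c) ^ 2 / 2) * Real.exp (v * t ^ 2 / 2) := by
        gcongr
        · exact mgf_nonneg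
        · exact Real.cosh_le_exp_half_sq _
        · exact hS.mgf_le t
    _ = _ := by
        rw [← Real.exp_add]; congr 1; push_cast; ring

/-- Azuma–Hoeffding on an arbitrary probability space. -/
lemma hasSubgaussianMGF_sum_of_condExp_eq_zero [IsProbabilityMeasure P]
    (ℱ : Filtration ℕ mΩ) {D : ℕ → Ω → ℝ} {c : ℕ → ℝ≥0}
    (hDm : ∀ i, StronglyMeasurable[ℱ (i + 1)] (D i)) (hD : ∀ i, ∀ᵐ ω ∂P, |D i ω| ≤ c i)
    (hD0 : ∀ i, P[D i | ℱ i] =ᵐ[P] 0) (n : ℕ) :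
    HasSubgaussianMGF (fun ω => ∑ i ∈ Finset.range n, D i ω) (∑ i ∈ Finset.range n, c i ^ 2) P := by
  induction n with
  | zero => simp
  | succ n ih =>
    simp only [Finset.sum_range_succ]
    refine ih.add_of_condExp_eq_zero (ℱ.le n) ?_ ((hDm n).mono (ℱ.le _)).aestronglyMeasurable
      (hD n) (hD0 n)
    refine Finset.stronglyMeasurable_fun_sum _ fun i hi => (hDm i).mono (ℱ.mono ?_)
    have := Finset.mem_range.1 hi
    omega

end Hoeffding

/-! ### Dyadic martingale decomposition -/

section Dyadic

variable {Ω : Type*} {mΩ : MeasurableSpace Ω} {P : Measure Ω}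
  {ℱ : Filtration ℕ mΩ} {Z : ℕ → Ω → ℝ} {b : ℕ → ℝ≥0}

/-- The sum of `Z` over the block of `m` consecutive times starting at `a`. -/
def blockSum {Ω : Type*} (Z : ℕ → Ω → ℝ) (a m : ℕ) : Ω → ℝ :=
  ∑ u ∈ Finset.range m, Z (a + u)

/-- The block sums of `M` consecutive blocks of length `m`, each predicted from the information
available when the block starts. -/
noncomputable def predictedSum (P : Measure Ω) (ℱ : Filtration ℕ mΩ) (Z : ℕ → Ω → ℝ) (m M : ℕ) :
    Ω → ℝ :=
  ∑ s ∈ Finset.range M, P[blockSum Z (s * m) m | ℱ (s * m)]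

lemma integrable_blockSum (hZ : ∀ i, Integrable (Z i) P) (a m : ℕ) :
    Integrable (blockSum Z a m) P :=
  integrable_finsetSum' _ fun _ _ => hZ _

lemma blockSum_add {Ω : Type*} (Z : ℕ → Ω → ℝ) (a m m' : ℕ) :
    blockSum Z a (m + m') = blockSum Z a m + blockSum Z (a + m) m' := by
  simp [blockSum, Finset.sum_range_add, add_assoc]

/-- The predicted block sum is bounded by the sum of the bounds `b k` on predictions `k` steps
beyond the present. With `ℱ i` the information before time `i`, `Z (i + k)` lies `k + 1` observations
ahead. -/
lemma abs_condExp_blockSum_le (hZ : ∀ i, Integrable (Z i) P)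
    (hb : ∀ i k, ∀ᵐ ω ∂P, |(P[Z (i + k) | ℱ i]) ω| ≤ b k) (a m : ℕ) :
    ∀ᵐ ω ∂P, |(P[blockSum Z a m | ℱ a]) ω| ≤ (∑ k ∈ Finset.range m, b k : ℝ≥0) := by
  have h1 : P[blockSum Z a m | ℱ a] =ᵐ[P] ∑ u ∈ Finset.range m, P[Z (a + u) | ℱ a] :=
    condExp_finsetSum (fun i _ => hZ _) _
  filter_upwards [h1, ae_all_iff.2 (hb a)] with ω h1 h2
  rw [h1, Finset.sum_apply, NNReal.coe_sum]
  exact (Finset.abs_sum_le_sum_abs _ _).trans (Finset.sum_le_sum fun k _ => h2 k)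

/-- Passing from blocks of length `2 * m` to blocks of length `m` changes the predicted sum by a
sum of bounded martingale differences: only the prediction of the second half of each long block is
updated, at the middle of the block. -/
lemma predictedSum_two_mul (hZ : ∀ i, Integrable (Z i) P) (m M : ℕ) :
    predictedSum P ℱ Z m (2 * M) =ᵐ[P] fun ω => predictedSum P ℱ Z (2 * m) M ω +
      ∑ s ∈ Finset.range M,
        (P[blockSum Z ((2 * s + 1) * m) m | ℱ ((2 * s + 1) * m)] -
          P[blockSum Z ((2 * s + 1) * m) m | ℱ (s * (2 * m))]) ω := by
  have key : ∀ s, P[blockSum Z (s * (2 * m)) (2 * m) | ℱ (s * (2 * m))] =ᵐ[P]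
      P[blockSum Z (2 * s * m) m | ℱ (2 * s * m)] +
        P[blockSum Z ((2 * s + 1) * m) m | ℱ (s * (2 * m))] := by
    intro s
    have e : blockSum Z (s * (2 * m)) (2 * m) =
        blockSum Z (2 * s * m) m + blockSum Z ((2 * s + 1) * m) m := by
      rw [two_mul m, blockSum_add]
      congr 2 <;> ring
    have e' : s * (2 * m) = 2 * s * m := by ring
    rw [e, e']
    exact condExp_add (integrable_blockSum hZ _ _) (integrable_blockSum hZ _ _) _
  filter_upwards [ae_all_iff.2 key] with ω hω
  have split : ∀ (f : ℕ → ℝ), ∑ s ∈ Finset.range (2 * M), f s =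
      ∑ s ∈ Finset.range M, (f (2 * s) + f (2 * s + 1)) := by
    intro f
    induction M with
    | zero => simp
    | succ M ih =>
      rw [Finset.sum_range_succ, ← ih, show 2 * (M + 1) = 2 * M + 1 + 1 by ring,
        Finset.sum_range_succ, Finset.sum_range_succ, add_assoc]
  simp only [predictedSum, Finset.sum_apply, Pi.sub_apply]
  rw [split, ← Finset.sum_add_distrib]
  refine Finset.sum_congr rfl fun s _ => ?_
  rw [hω s, Pi.add_apply]
  ring

/-- The change between two consecutive scales. Each of the two predictions of a half-block is
bounded by the partial sum of `b`, so their difference is bounded by twice that sum. -/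
lemma hasSubgaussianMGF_sum_update [IsProbabilityMeasure P]
    (hZ : ∀ i, Integrable (Z i) P)
    (hb : ∀ i k, ∀ᵐ ω ∂P, |(P[Z (i + k) | ℱ i]) ω| ≤ b k) (m M : ℕ) :
    HasSubgaussianMGF (fun ω => ∑ s ∈ Finset.range M,
        (P[blockSum Z ((2 * s + 1) * m) m | ℱ ((2 * s + 1) * m)] -
          P[blockSum Z ((2 * s + 1) * m) m | ℱ (s * (2 * m))]) ω)
      ((NNReal.sqrt M * (2 * ∑ k ∈ Finset.range m, b k)) ^ 2) P := by
  let 𝒢 : Filtration ℕ mΩ :=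
    { seq := fun s => ℱ (s * (2 * m))
      mono' := fun s t h => ℱ.mono (Nat.mul_le_mul_right _ h)
      le' := fun s => ℱ.le _ }
  have hle : ∀ s, ℱ (s * (2 * m)) ≤ ℱ ((2 * s + 1) * m) := fun s => ℱ.mono (by nlinarith)
  have hle' : ∀ s, ℱ ((2 * s + 1) * m) ≤ ℱ ((s + 1) * (2 * m)) := fun s => ℱ.mono (by nlinarith)
  have tower : ∀ s, P[P[blockSum Z ((2 * s + 1) * m) m | ℱ ((2 * s + 1) * m)] | ℱ (s * (2 * m))]
      =ᵐ[P] P[blockSum Z ((2 * s + 1) * m) m | ℱ (s * (2 * m))] := fun s =>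
    condExp_condExp_of_le (hle s) (ℱ.le _)
  have h := hasSubgaussianMGF_sum_of_condExp_eq_zero (P := P) 𝒢
    (D := fun s => P[blockSum Z ((2 * s + 1) * m) m | ℱ ((2 * s + 1) * m)] -
          P[blockSum Z ((2 * s + 1) * m) m | ℱ (s * (2 * m))])
    (c := fun _ => 2 * ∑ k ∈ Finset.range m, b k) ?_ ?_ ?_ M
  · convert h using 1
    rw [mul_pow, NNReal.sq_sqrt]
    simp
  · intro s
    exact (stronglyMeasurable_condExp.mono (hle' s)).sub
      (stronglyMeasurable_condExp.mono ((hle s).trans (hle' s)))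
  · intro s
    have h1 := abs_condExp_blockSum_le hZ hb ((2 * s + 1) * m) m
    have h2 := ae_bdd_abs_condExp_of_ae_bdd_abs (m := ℱ (s * (2 * m))) h1
    filter_upwards [h1, h2, tower s] with ω h1 h2 h3
    rw [h3] at h2
    rw [Pi.sub_apply, NNReal.coe_mul, NNReal.coe_ofNat, two_mul (_ : ℝ)]
    exact (abs_sub _ _).trans (add_le_add h1 h2)
  · intro s
    have h1 := condExp_sub (m := ℱ (s * (2 * m))) (μ := P)
      (f := P[blockSum Z ((2 * s + 1) * m) m | ℱ ((2 * s + 1) * m)])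
      (g := P[blockSum Z ((2 * s + 1) * m) m | ℱ (s * (2 * m))])
      integrable_condExp integrable_condExp
    have h2 := condExp_of_stronglyMeasurable (μ := P) (ℱ.le (s * (2 * m)))
      (f := P[blockSum Z ((2 * s + 1) * m) m | ℱ (s * (2 * m))])
      stronglyMeasurable_condExp integrable_condExp
    refine h1.trans ?_
    filter_upwards [tower s] with ω h3
    rw [Pi.sub_apply, h3, h2]
    simp

/-- Coarsening `r` times leaves a single block starting at time `0`, whose prediction vanishes by
`h0`; the parameters of the `r` changes of scale add up. -/
lemma hasSubgaussianMGF_predictedSum [IsProbabilityMeasure P]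
    (hZ : ∀ i, Integrable (Z i) P)
    (hb : ∀ i k, ∀ᵐ ω ∂P, |(P[Z (i + k) | ℱ i]) ω| ≤ b k)
    (h0 : ∀ i, P[Z i | ℱ 0] =ᵐ[P] 0) (r m : ℕ) :
    HasSubgaussianMGF (predictedSum P ℱ Z m (2 ^ r))
      ((∑ i ∈ Finset.range r, NNReal.sqrt (2 ^ (r - 1 - i)) *
        (2 * ∑ k ∈ Finset.range (2 ^ i * m), b k)) ^ 2) P := by
  induction r generalizing m with
  | zero =>
    have h : (fun _ => 0) =ᵐ[P] predictedSum P ℱ Z m (2 ^ 0) := by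
      have h1 : P[blockSum Z 0 m | ℱ 0] =ᵐ[P] ∑ u ∈ Finset.range m, P[Z (0 + u) | ℱ 0] :=
        condExp_finsetSum (fun i _ => hZ _) _
      filter_upwards [h1, ae_all_iff.2 h0] with ω h1 h2
      simp [predictedSum, h1, h2]
    simpa using HasSubgaussianMGF.fun_zero.congr h
  | succ r ih =>
    rw [pow_succ', Finset.sum_range_succ']
    refine HasSubgaussianMGF.congr ?_ (predictedSum_two_mul hZ m (2 ^ r)).symm
    have h := (ih (2 * m)).add_sq (hasSubgaussianMGF_sum_update hZ hb m (2 ^ r))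
    convert h using 4 with i
    · congr 2
      · rw [show r + 1 - 1 - (i + 1) = r - 1 - i by omega]
      · congr 2; ring
    · simp
    · simp

/-- The martingale-plus-prediction decomposition at the finest scale, followed by the dyadic
coarsening of the predicted part. -/
lemma hasSubgaussianMGF_sum_dyadic [IsProbabilityMeasure P]
    (hZ : ∀ i, StronglyMeasurable[ℱ (i + 1)] (Z i))
    (hZi : ∀ i, Integrable (Z i) P)
    (hb : ∀ i k, ∀ᵐ ω ∂P, |(P[Z (i + k) | ℱ i]) ω| ≤ b k)
    (h0 : ∀ i, P[Z i | ℱ 0] =ᵐ[P] 0) {c : ℕ → ℝ≥0}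
    (hc : ∀ i, ∀ᵐ ω ∂P, |Z i ω - (P[Z i | ℱ i]) ω| ≤ c i) (r : ℕ) :
    HasSubgaussianMGF (fun ω => ∑ i ∈ Finset.range (2 ^ r), Z i ω)
      ((NNReal.sqrt (∑ i ∈ Finset.range (2 ^ r), c i ^ 2) + ∑ i ∈ Finset.range r,
        NNReal.sqrt (2 ^ (r - 1 - i)) * (2 * ∑ k ∈ Finset.range (2 ^ i), b k)) ^ 2) P := by
  have h1 := hasSubgaussianMGF_sum_of_condExp_eq_zero (P := P) ℱ
    (D := fun i => Z i - P[Z i | ℱ i]) (c := c)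
    (fun i => (hZ i).sub (stronglyMeasurable_condExp.mono (ℱ.mono (Nat.le_succ i)))) hc
    (fun i => by
      refine (condExp_sub (hZi i) integrable_condExp _).trans ?_
      rw [condExp_of_stronglyMeasurable (ℱ.le i) (f := P[Z i | ℱ i])
        stronglyMeasurable_condExp integrable_condExp, sub_self]) (2 ^ r)
  rw [← NNReal.sq_sqrt (∑ i ∈ Finset.range (2 ^ r), c i ^ 2)] at h1
  have h2 := h1.add_sq (hasSubgaussianMGF_predictedSum hZi hb h0 r 1)
  simp only [mul_one] at h2
  convert h2 using 2 with ω
  simp [predictedSum, blockSum, Finset.sum_sub_distrib]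

end Dyadic

/-! ### From dyadic scales to the weights `j ^ (-3/2)` -/

section Weights

/-- The dyadic sum is controlled by the series with weights `j ^ (-3/2)`. The terms
`j ∈ (M, 2 * M]` of the series pay for the scale `2 * M`, because monotonicity of `b` makes the
partial sums of `b` at most double from `M` to `2 * M`. -/
lemma sum_dyadic_le {b : ℕ → ℝ} (hb : Antitone b) (hb0 : ∀ k, 0 ≤ b k) (r : ℕ) :
    ∑ i ∈ Finset.range (r + 1), (√(2 ^ i : ℝ))⁻¹ * ∑ k ∈ Finset.range (2 ^ i), b k ≤
      4 * ∑ j ∈ Finset.Icc (1 : ℕ) (2 ^ r),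
        (j : ℝ) ^ (-(3 / 2) : ℝ) * ∑ k ∈ Finset.range j, b k := by
  have hΔ : ∀ {i j : ℕ}, i ≤ j → ∑ k ∈ Finset.range i, b k ≤ ∑ k ∈ Finset.range j, b k :=
    fun h => Finset.sum_le_sum_of_subset_of_nonneg (Finset.range_subset_range.2 h)
      fun k _ _ => hb0 k
  induction r with
  | zero => simp; linarith [hb0 0]
  | succ r ih =>
    rw [Finset.sum_range_succ]
    have hsplit : Finset.Icc 1 (2 ^ (r + 1)) =
        (Finset.Icc 1 (2 ^ r)).disjUnion (Finset.Ioc (2 ^ r) (2 ^ (r + 1)))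
          (Finset.disjoint_left.2 fun x h1 h2 => by
            simp only [Finset.mem_Icc, Finset.mem_Ioc] at h1 h2; omega) := by
      ext x
      have : 2 ^ (r + 1) = 2 * 2 ^ r := by ring
      have : 1 ≤ 2 ^ r := Nat.one_le_two_pow
      simp only [Finset.mem_Icc, Finset.mem_Ioc, Finset.mem_disjUnion]
      omega
    rw [hsplit, Finset.sum_disjUnion, mul_add]
    refine add_le_add ih ?_
    set M := 2 ^ r with hM
    have hM1 : 1 ≤ M := Nat.one_le_two_pow
    have h2M : 2 ^ (r + 1) = M + M := by rw [hM]; ring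
    set Δ := ∑ k ∈ Finset.range M, b k with hΔM
    have hΔ0 : 0 ≤ Δ := Finset.sum_nonneg fun k _ => hb0 k
    have hdouble : ∑ k ∈ Finset.range (2 ^ (r + 1)), b k ≤ 2 * Δ := by
      rw [h2M, Finset.sum_range_add, two_mul]
      exact add_le_add le_rfl (Finset.sum_le_sum fun k _ => hb (Nat.le_add_left k M))
    have hcast : (2 ^ (r + 1) : ℝ) = ((M + M : ℕ) : ℝ) := by rw [← h2M]; push_cast; ring
    set x : ℝ := ((M + M : ℕ) : ℝ) with hx
    have hx0 : 0 < x := by rw [hx]; exact_mod_cast (by omega : 0 < M + M)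
    have hlow : (M : ℝ) * (x ^ (-(3 / 2) : ℝ) * Δ) ≤ ∑ j ∈ Finset.Ioc M (2 ^ (r + 1)),
        (j : ℝ) ^ (-(3 / 2) : ℝ) * ∑ k ∈ Finset.range j, b k := by
      have hcard : (Finset.Ioc M (2 ^ (r + 1))).card = M := by rw [h2M]; simp
      have := Finset.card_nsmul_le_sum (Finset.Ioc M (2 ^ (r + 1)))
        (fun j => (j : ℝ) ^ (-(3 / 2) : ℝ) * ∑ k ∈ Finset.range j, b k)
        (x ^ (-(3 / 2) : ℝ) * Δ) fun j hj => by
          rw [Finset.mem_Ioc, h2M] at hj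
          have hj0 : (0 : ℝ) < j := by exact_mod_cast (by omega : 0 < j)
          refine mul_le_mul ?_ (hΔ hj.1.le) hΔ0 (by positivity)
          exact Real.rpow_le_rpow_of_nonpos hj0 (by rw [hx]; exact_mod_cast hj.2) (by norm_num)
      rwa [hcard, nsmul_eq_mul] at this
    have hpow : x ^ (-(3 / 2) : ℝ) * x = (√x)⁻¹ := by
      rw [Real.sqrt_eq_rpow, ← Real.rpow_neg hx0.le]
      nth_rewrite 2 [← Real.rpow_one x]
      rw [← Real.rpow_add hx0]
      norm_num
    have hxM : x = 2 * M := by rw [hx]; push_cast; ring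
    calc (√(2 ^ (r + 1) : ℝ))⁻¹ * ∑ k ∈ Finset.range (2 ^ (r + 1)), b k
        ≤ (√x)⁻¹ * (2 * Δ) := by rw [hcast]; gcongr
      _ = 4 * ((M : ℝ) * (x ^ (-(3 / 2) : ℝ) * Δ)) := by rw [← hpow, hxM]; ring
      _ ≤ _ := by gcongr

end Weights

/-! ### The sub-Gaussian bound and the deviation inequality it gives -/

section Tail

variable {Ω : Type*} {mΩ : MeasurableSpace Ω} {P : Measure Ω}

lemma _root_.ProbabilityTheory.HasSubgaussianMGF.mono {X : Ω → ℝ} {c d : ℝ≥0}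
    (hX : HasSubgaussianMGF X c P) (h : c ≤ d) : HasSubgaussianMGF X d P :=
  ⟨hX.integrable_exp_mul, fun t => (hX.mgf_le t).trans (by gcongr)⟩

/-- The sub-Gaussian bound for bounded variables. Extending `Z` by zero beyond time `n` makes the
dyadic decomposition of a horizon `2 ^ r ≥ n` available. -/
lemma hasSubgaussianMGF_sum_range [IsProbabilityMeasure P]
    {ℱ : Filtration ℕ mΩ} {Z : ℕ → Ω → ℝ} {b : ℕ → ℝ≥0}
    (hZ : ∀ i, StronglyMeasurable[ℱ (i + 1)] (Z i)) (hZi : ∀ i, Integrable (Z i) P)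
    (hb : ∀ i k, ∀ᵐ ω ∂P, |(P[Z (i + k) | ℱ i]) ω| ≤ b k)
    (h0 : ∀ i, P[Z i | ℱ 0] =ᵐ[P] 0)
    (hc : ∀ i, ∀ᵐ ω ∂P, |Z i ω - (P[Z i | ℱ i]) ω| ≤ 1) (hba : Antitone b)
    {n : ℕ} (hZn : ∀ i, n ≤ i → Z i = 0) :
    HasSubgaussianMGF (fun ω => ∑ i ∈ Finset.range n, Z i ω)
      ((NNReal.sqrt n * (1 + 8 * ∑ j ∈ Finset.Icc 1 n,
        (j : ℝ≥0) ^ (-(3 / 2) : ℝ) * ∑ k ∈ Finset.range j, b k)) ^ 2) P := by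
  set r := Nat.clog 2 n with hr
  have hnr : n ≤ 2 ^ r := Nat.le_pow_clog one_lt_two n
  have h := hasSubgaussianMGF_sum_dyadic hZ hZi hb h0 (c := fun i => if i < n then 1 else 0)
    (fun i => by
      by_cases hi : i < n
      · simpa [hi] using hc i
      · simp [hi, hZn i (not_lt.1 hi)]) r
  have hsub : Finset.range n ⊆ Finset.range (2 ^ r) := Finset.range_subset_range.2 hnr
  have hS : (fun ω => ∑ i ∈ Finset.range (2 ^ r), Z i ω) =
      fun ω => ∑ i ∈ Finset.range n, Z i ω := by
    funext ω
    refine (Finset.sum_subset hsub fun i _ hi => ?_).symm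
    rw [hZn i (by simpa using hi)]
    rfl
  have hvar : ∑ i ∈ Finset.range (2 ^ r), (if i < n then (1 : ℝ≥0) else 0) ^ 2 = n := by
    rw [← Finset.sum_subset hsub fun i _ hi => by
      simp only [Finset.mem_range] at hi; simp [hi]]
    rw [Finset.sum_congr rfl fun i hi => by rw [if_pos (Finset.mem_range.1 hi)]]
    simp
  rw [hS, hvar] at h
  refine h.mono (pow_le_pow_left₀ zero_le ?_ 2)
  rw [mul_add, mul_one]
  gcongr
  -- Every scale `2 ^ i` that occurs satisfies `2 ^ i ≤ 2 ^ q < n`, where `r = q + 1`.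
  rcases Nat.eq_zero_or_pos r with h0 | h0
  · rw [h0]; simp
  obtain ⟨q, hq⟩ := Nat.exists_eq_succ_of_ne_zero h0.ne'
  have hqn : 2 ^ q < n := by
    rw [← Nat.lt_clog_iff_pow_lt one_lt_two]
    omega
  have hscale : ∀ i ∈ Finset.range (q + 1), NNReal.sqrt (2 ^ (q + 1 - 1 - i)) *
      (2 * ∑ k ∈ Finset.range (2 ^ i), b k) ≤
      NNReal.sqrt n * 2 * ((NNReal.sqrt (2 ^ i))⁻¹ * ∑ k ∈ Finset.range (2 ^ i), b k) := by
    intro i hi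
    have hi : i ≤ q := Nat.lt_succ_iff.1 (Finset.mem_range.1 hi)
    have h1 : NNReal.sqrt (2 ^ (q - i)) ≤ NNReal.sqrt n * (NNReal.sqrt (2 ^ i))⁻¹ := by
      rw [← NNReal.sqrt_inv, ← NNReal.sqrt_mul]
      refine NNReal.sqrt_le_sqrt.2 ?_
      rw [pow_sub₀ _ two_ne_zero hi]
      gcongr
      exact_mod_cast hqn.le
    calc _ ≤ (NNReal.sqrt n * (NNReal.sqrt (2 ^ i))⁻¹) *
          (2 * ∑ k ∈ Finset.range (2 ^ i), b k) := by gcongr; exact h1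
      _ = _ := by ring
  have hdy : ∑ i ∈ Finset.range (q + 1),
      ((NNReal.sqrt (2 ^ i))⁻¹ * ∑ k ∈ Finset.range (2 ^ i), b k) ≤
      4 * ∑ j ∈ Finset.Icc (1 : ℕ) (2 ^ q),
        (j : ℝ≥0) ^ (-(3 / 2) : ℝ) * ∑ k ∈ Finset.range j, b k := by
    rw [← NNReal.coe_le_coe]
    push_cast
    exact sum_dyadic_le (b := fun k => (b k : ℝ)) (fun i j hij => hba hij) (fun k => (b k).2) q
  rw [hq]
  refine (Finset.sum_le_sum hscale).trans ?_
  rw [← Finset.mul_sum, mul_assoc]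
  refine mul_le_mul_of_nonneg_left ?_ zero_le
  calc _ ≤ 2 * (4 * ∑ j ∈ Finset.Icc (1 : ℕ) (2 ^ q),
        (j : ℝ≥0) ^ (-(3 / 2) : ℝ) * ∑ k ∈ Finset.range j, b k) :=
        mul_le_mul_of_nonneg_left hdy zero_le
    _ = 8 * ∑ j ∈ Finset.Icc (1 : ℕ) (2 ^ q),
        (j : ℝ≥0) ^ (-(3 / 2) : ℝ) * ∑ k ∈ Finset.range j, b k := by ring
    _ ≤ _ := by
      exact mul_le_mul_of_nonneg_left
        (Finset.sum_le_sum_of_subset (Finset.Icc_subset_Icc_right hqn.le)) zero_le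

/-- Two-sided sub-Gaussian deviation bound at the level `exp (-L)`. -/
lemma _root_.ProbabilityTheory.HasSubgaussianMGF.measure_abs_ge_le [IsProbabilityMeasure P]
    {X : Ω → ℝ} {σ : ℝ≥0}
    (hX : HasSubgaussianMGF X (σ ^ 2) P) (hσ : 0 < σ) {L : ℝ} (hL : 0 ≤ L) :
    P.real {ω | σ * √(2 * L) ≤ |X ω|} ≤ 2 * Real.exp (-L) := by
  have hε : (0 : ℝ) ≤ σ * √(2 * L) := by positivity
  have hval : -((σ : ℝ) * √(2 * L)) ^ 2 / (2 * ((σ ^ 2 : ℝ≥0) : ℝ)) = -L := by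
    have : (0 : ℝ) < σ := hσ
    rw [mul_pow, Real.sq_sqrt (by positivity)]
    push_cast
    field_simp
  have h1 := hX.measure_ge_le hε
  have h2 := hX.neg.measure_ge_le hε
  rw [hval] at h1 h2
  have hsub : {ω | σ * √(2 * L) ≤ |X ω|} ⊆
      {ω | σ * √(2 * L) ≤ X ω} ∪ {ω | σ * √(2 * L) ≤ (-X) ω} := by
    intro ω hω
    exact le_abs.1 (Set.mem_ofPred_eq ▸ hω)
  calc _ ≤ _ := measureReal_mono hsub
    _ ≤ _ := measureReal_union_le _ _
    _ ≤ _ := by linarith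

end Tail

/-! ### The past of the process and the mixing coefficients -/

section Mixing

lemma past_zero {Ω : Type*} (X : ℕ → Ω → unitInterval) : past X 0 = ⊥ := by
  simp [past]

lemma past_mono {Ω : Type*} (X : ℕ → Ω → unitInterval) : Monotone (past X) := fun _ _ h =>
  biSup_mono fun _ hj => ⟨hj.1, hj.2.trans h⟩

lemma measurable_past {Ω : Type*} {X : ℕ → Ω → unitInterval} {i j : ℕ} (hj : 1 ≤ j)
    (hji : j ≤ i) : Measurable[past X i] (X j) :=
  Measurable.mono (comap_measurable (X j))
    (le_iSup₂_of_le (f := fun j _ => MeasurableSpace.comap (X j) inferInstance) j ⟨hj, hji⟩ le_rfl)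
    le_rfl

variable {Ω : Type*} [MeasurableSpace Ω] {P : Measure Ω} {𝒞 : TestClass} {X : ℕ → Ω → unitInterval}

lemma past_le (hX : ∀ t : ℕ, 1 ≤ t → Measurable (X t)) (i : ℕ) :
    past X i ≤ ‹MeasurableSpace Ω› :=
  iSup₂_le fun j hj => (hX j hj.1).comap_le

/-- Conditioning on a smaller σ-algebra contracts the `L^∞` norm, and
`(i + 1) + k = i + (k + 1)`. -/
lemma mixingCoeff_antitone [IsProbabilityMeasure P] (hX : ∀ t : ℕ, 1 ≤ t → Measurable (X t)) :
    Antitone (mixingCoeff 𝒞 X P) := by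
  refine antitone_nat_of_succ_le fun k => ?_
  refine iSup₂_le fun φ hφ => iSup₂_le fun i hi => ?_
  refine le_trans ?_ (le_iSup₂_of_le (i := φ) (j := hφ) (le_iSup₂_of_le (i := i + 1)
    (j := Nat.le_add_left 1 i) le_rfl))
  rw [show i + 1 + k = i + (k + 1) by ring]
  set f : Ω → ℝ := fun ω' => φ (X (i + (k + 1)) ω')
  set c : ℝ := ∫ ω', φ (X (i + (k + 1)) ω') ∂P
  refine le_trans (le_of_eq (eLpNorm_congr_ae ?_))
    (eLpNorm_condExp_le_eLpNorm (m := past X i) (μ := P)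
      (fun ω => (P[f | past X (i + 1)]) ω - c) le_top)
  have h1 : P[P[f | past X (i + 1)] - (fun _ => c) | past X i] =ᵐ[P] _ :=
    condExp_sub integrable_condExp (integrable_const c) _
  have h2 := condExp_condExp_of_le (f := f) (μ := P) (past_mono X (Nat.le_succ i))
    (past_le hX (i + 1))
  refine Filter.EventuallyEq.symm (h1.trans ?_)
  rw [condExp_const (past_le hX i)]
  filter_upwards [h2] with ω h2
  rw [Pi.sub_apply, h2]

lemma ae_ofReal_abs_condExp_sub_le
    (hid : (fun x : unitInterval => (x : ℝ)) ∈ 𝒞.unitBall) {i : ℕ} (hi : 1 ≤ i) (k : ℕ) :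
    ∀ᵐ ω ∂P, ENNReal.ofReal |(P[fun ω' => (X (i + k) ω' : ℝ) | past X i]) ω
      - ∫ ω', (X (i + k) ω' : ℝ) ∂P| ≤ mixingCoeff 𝒞 X P k := by
  have hle : eLpNorm (fun ω => (P[fun ω' => (X (i + k) ω' : ℝ) | past X i]) ω
      - ∫ ω', (X (i + k) ω' : ℝ) ∂P) ∞ P ≤ mixingCoeff 𝒞 X P k :=
    le_iSup₂_of_le (i := fun x : unitInterval => (x : ℝ)) (j := hid)
      (le_iSup₂_of_le (i := i) (j := hi) le_rfl)
  rw [eLpNorm_exponent_top] at hle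
  filter_upwards [ae_le_eLpNormEssSup (μ := P) (f := fun ω =>
    (P[fun ω' => (X (i + k) ω' : ℝ) | past X i]) ω - ∫ ω', (X (i + k) ω' : ℝ) ∂P)] with ω hω
  refine le_trans (le_of_eq ?_) (hω.trans hle)
  rw [← Real.norm_eq_abs, ofReal_norm]

/-- The mixing coefficient at lag `k * (l + 1)`, truncated at the trivial bound `1` for the
centred process, and hence finite. -/
noncomputable def truncatedCoeff (𝒞 : TestClass) (X : ℕ → Ω → unitInterval) (P : Measure Ω)
    (k l : ℕ) : ℝ≥0 :=
  (min (mixingCoeff 𝒞 X P (k * (l + 1))) 1).toNNReal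

lemma coe_truncatedCoeff (k l : ℕ) : (truncatedCoeff 𝒞 X P k l : ℝ≥0∞) =
    min (mixingCoeff 𝒞 X P (k * (l + 1))) 1 :=
  ENNReal.coe_toNNReal (ne_top_of_le_ne_top ENNReal.one_ne_top (min_le_right _ _))

lemma antitone_truncatedCoeff [IsProbabilityMeasure P] (hX : ∀ t : ℕ, 1 ≤ t → Measurable (X t))
    (k : ℕ) : Antitone (truncatedCoeff 𝒞 X P k) := by
  intro l l' h
  rw [← ENNReal.coe_le_coe, coe_truncatedCoeff, coe_truncatedCoeff]
  exact min_le_min_right _ (mixingCoeff_antitone hX (Nat.mul_le_mul_left k (by omega)))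

/-! ### Deviation of the sampled mean -/

/-- The centred process sampled with gap `k` is sub-Gaussian. The σ-algebra at time `0` is trivial,
so no mixing assumption is needed for predictions made at time `0`. -/
lemma hasSubgaussianMGF_sum_sub [IsProbabilityMeasure P]
    (hid : (fun x : unitInterval => (x : ℝ)) ∈ 𝒞.unitBall)
    (hX : ∀ t : ℕ, 1 ≤ t → Measurable (X t)) {μ : ℝ}
    (hμ : ∀ t : ℕ, 1 ≤ t → ∫ ω, (X t ω : ℝ) ∂P = μ) (n : ℕ) {k : ℕ} (hk : 1 ≤ k) :
    HasSubgaussianMGF (fun ω => ∑ i ∈ Finset.range n, ((X (k * (i + 1)) ω : ℝ) - μ))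
      ((NNReal.sqrt n * (1 + 8 * ∑ j ∈ Finset.Icc 1 n, (j : ℝ≥0) ^ (-(3 / 2) : ℝ) *
        ∑ l ∈ Finset.range j, truncatedCoeff 𝒞 X P k l)) ^ 2) P := by
  let ℱ : Filtration ℕ ‹MeasurableSpace Ω› :=
    { seq := fun i => past X (k * i)
      mono' := fun i j h => past_mono X (Nat.mul_le_mul_left k h)
      le' := fun i => past_le hX _ }
  have hpos : ∀ i, 1 ≤ k * (i + 1) := fun i => Nat.mul_pos hk (Nat.succ_pos i)
  have hXm : ∀ i, Measurable fun ω => (X (k * (i + 1)) ω : ℝ) := fun i =>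
    measurable_subtype_coe.comp (hX _ (hpos i))
  have hXi : ∀ i, Integrable (fun ω => (X (k * (i + 1)) ω : ℝ)) P := fun i =>
    .of_bound (hXm i).aestronglyMeasurable 1 (.of_forall fun ω => by
      rw [Real.norm_of_nonneg (X _ ω).2.1]; exact (X _ ω).2.2)
  have hμ0 : 0 ≤ μ := by
    rw [← hμ 1 le_rfl]; exact integral_nonneg fun ω => (X 1 ω).2.1
  have hμ1 : μ ≤ 1 := by
    rw [← hμ _ (hpos 0)]
    calc _ ≤ ∫ _, (1 : ℝ) ∂P := integral_mono (hXi 0) (integrable_const _) fun ω => (X _ ω).2.2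
      _ = 1 := by simp
  set Z : ℕ → Ω → ℝ := fun i => if i < n then fun ω => (X (k * (i + 1)) ω : ℝ) - μ else 0 with hZ
  have hZlt : ∀ {i}, i < n → Z i = fun ω => (X (k * (i + 1)) ω : ℝ) - μ := fun h => if_pos h
  have hZge : ∀ {i}, n ≤ i → Z i = 0 := fun h => if_neg (not_lt.2 h)
  have hcond : ∀ {i} (j : ℕ), i < n → P[Z i | ℱ j] =ᵐ[P]
      fun ω => (P[fun ω' => (X (k * (i + 1)) ω' : ℝ) | past X (k * j)]) ω - μ := by
    intro i j hi
    rw [hZlt hi]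
    refine (condExp_sub (hXi i) (integrable_const μ) _).trans ?_
    rw [condExp_const (ℱ.le j)]
    rfl
  have hZ1 : ∀ i, ∀ᵐ ω ∂P, |Z i ω| ≤ 1 := fun i => .of_forall fun ω => by
    rcases lt_or_ge i n with hi | hi
    · rw [hZlt hi, abs_le]
      constructor <;> linarith [(X (k * (i + 1)) ω).2.1, (X (k * (i + 1)) ω).2.2]
    · simp [hZge hi]
  have h0 : ∀ i, P[Z i | ℱ 0] =ᵐ[P] 0 := by
    intro i
    rcases lt_or_ge i n with hi | hi
    · refine (hcond 0 hi).trans (.of_forall fun ω => ?_)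
      rw [mul_zero, past_zero, condExp_bot, hμ _ (hpos i)]
      exact sub_self μ
    · rw [hZge hi, condExp_zero]
  have hmain := hasSubgaussianMGF_sum_range (P := P) (ℱ := ℱ) (Z := Z)
    (b := truncatedCoeff 𝒞 X P k) ?_ ?_ ?_ h0 ?_ (antitone_truncatedCoeff hX k)
    (n := n) (fun i hi => hZge hi)
  · convert hmain using 4 with ω i hi
    rw [hZlt (Finset.mem_range.1 hi)]
  · intro i
    rcases lt_or_ge i n with hi | hi
    · rw [hZlt hi]
      have h1 : Measurable[past X (k * (i + 1))] (X (k * (i + 1))) :=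
        measurable_past (hpos i) le_rfl
      exact ((measurable_subtype_coe.comp h1).sub_const μ).stronglyMeasurable
    · rw [hZge hi]
      exact stronglyMeasurable_zero
  · intro i
    rcases lt_or_ge i n with hi | hi
    · rw [hZlt hi]
      exact (hXi i).sub (integrable_const μ)
    · rw [hZge hi]
      exact integrable_zero _ _ _
  · intro i l
    rcases lt_or_ge (i + l) n with hi | hi
    · rcases Nat.eq_zero_or_pos i with rfl | hi0
      · filter_upwards [h0 (0 + l)] with ω hω
        rw [hω]
        simp
      · have h1 := ae_ofReal_abs_condExp_sub_le (P := P) (X := X) hid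
          (Nat.mul_pos hk hi0) (k * (l + 1))
        rw [show k * i + k * (l + 1) = k * (i + l + 1) by ring, hμ _ (hpos (i + l))] at h1
        filter_upwards [h1, hcond i hi,
          ae_bdd_abs_condExp_of_ae_bdd_abs (m := ℱ i) (hZ1 (i + l))] with ω h1 h2 h3
        rw [← ENNReal.ofReal_le_ofReal_iff (NNReal.coe_nonneg _), ENNReal.ofReal_coe_nnreal,
          coe_truncatedCoeff]
        refine le_min ?_ ?_
        · rw [h2]; exact h1
        · exact ENNReal.ofReal_le_one.2 h3
    · rw [hZge hi, condExp_zero]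
      simp
  · intro i
    rcases lt_or_ge i n with hi | hi
    · have hlow : 0 ≤ᵐ[P] P[fun ω' => (X (k * (i + 1)) ω' : ℝ) | past X (k * i)] :=
        condExp_nonneg (.of_forall fun ω => (X _ ω).2.1)
      have hupp : P[fun ω' => (X (k * (i + 1)) ω' : ℝ) | past X (k * i)] ≤ᵐ[P]
          P[fun _ => (1 : ℝ) | past X (k * i)] :=
        condExp_mono (hXi i) (integrable_const _) (.of_forall fun ω => (X _ ω).2.2)
      rw [condExp_const (past_le hX _)] at hupp
      filter_upwards [hlow, hupp, hcond i hi] with ω h1 h2 h3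
      rw [h3, hZlt hi, abs_le]
      simp only [Pi.zero_apply] at h1
      constructor <;> linarith [(X (k * (i + 1)) ω).2.1, (X (k * (i + 1)) ω).2.2]
    · rw [hZge hi, condExp_zero]
      simp

lemma sum_Icc_one_eq_sum_range {M : Type*} [AddCommMonoid M] (f : ℕ → M) (n : ℕ) :
    ∑ t ∈ Finset.Icc 1 n, f t = ∑ i ∈ Finset.range n, f (i + 1) := by
  induction n with
  | zero => simp
  | succ n ih => rw [Finset.sum_Icc_succ_top (by omega), ih, Finset.sum_range_succ]

/-- With `T` the weighted sum of truncated coefficients and `A = 4 * √e`, a sub-Gaussian parameter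
at most `√n * (1 + 80 * T)` bounds the failure probability by
`2 * exp (-log (A / δ)) = 2 * δ / A`, and `2 ≤ A`. -/
theorem deviation_gap_sample [IsProbabilityMeasure P]
    (hid : (fun x : unitInterval => (x : ℝ)) ∈ 𝒞.unitBall)
    (hX : ∀ t : ℕ, 1 ≤ t → Measurable (X t)) {μ : ℝ}
    (hμ : ∀ t : ℕ, 1 ≤ t → ∫ ω, (X t ω : ℝ) ∂P = μ) {n : ℕ} (hn : 1 ≤ n) {δ : ℝ} (hδ0 : 0 < δ)
    (hδ1 : δ < 1) {k : ℕ} (hk : 1 ≤ k) :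
    1 - δ ≤ P.real {ω |
      ENNReal.ofReal |(n : ℝ)⁻¹ * (∑ t ∈ Finset.Icc 1 n, (X (k * t) ω : ℝ)) - μ| ≤
        (1 + 80 * ∑ j ∈ Finset.Icc 1 n, ENNReal.ofReal ((j : ℝ) ^ (-(3 / 2) : ℝ)) *
            ∑ l ∈ Finset.Icc 1 j, mixingCoeff 𝒞 X P (k * l)) *
          ENNReal.ofReal (Real.sqrt
            (2 * Real.log (4 * Real.sqrt (Real.exp 1) / δ) / (n : ℝ)))} := by
  set A : ℝ := 4 * √(Real.exp 1) with hA
  have hA4 : 4 ≤ A := by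
    have : 1 ≤ √(Real.exp 1) := Real.one_le_sqrt.2 (Real.one_le_exp zero_le_one)
    linarith
  set L : ℝ := Real.log (A / δ) with hL
  have hAδ : 1 ≤ A / δ := by rw [le_div_iff₀ hδ0]; linarith
  have hL0 : 0 ≤ L := Real.log_nonneg hAδ
  set T : ℝ≥0 := ∑ j ∈ Finset.Icc 1 n, (j : ℝ≥0) ^ (-(3 / 2) : ℝ) *
        ∑ l ∈ Finset.range j, truncatedCoeff 𝒞 X P k l with hT
  have hn0 : (0 : ℝ) < n := by exact_mod_cast hn
  have hσ : 0 < NNReal.sqrt n * (1 + 8 * T) := by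
    have : (0 : ℝ≥0) < n := by exact_mod_cast hn
    have := NNReal.sqrt_pos.2 this
    positivity
  have htail := (hasSubgaussianMGF_sum_sub (P := P) hid hX hμ n hk).measure_abs_ge_le hσ hL0
  set S : Set Ω := {ω | ENNReal.ofReal
      |(n : ℝ)⁻¹ * (∑ t ∈ Finset.Icc 1 n, (X (k * t) ω : ℝ)) - μ| ≤
        (1 + 80 * ∑ j ∈ Finset.Icc 1 n, ENNReal.ofReal ((j : ℝ) ^ (-(3 / 2) : ℝ)) *
            ∑ l ∈ Finset.Icc 1 j, mixingCoeff 𝒞 X P (k * l)) *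
          ENNReal.ofReal (√(2 * L / (n : ℝ)))} with hS
  set B : Set Ω := {ω | ((NNReal.sqrt n * (1 + 8 * T) : ℝ≥0) : ℝ) * √(2 * L) ≤
    |∑ i ∈ Finset.range n, ((X (k * (i + 1)) ω : ℝ) - μ)|} with hB
  -- `T` is finite although the coefficients may be infinite: the truncated coefficients give a
  -- finite lower bound for the radius.
  have hradius : ENNReal.ofReal ((1 + 80 * T) * √(2 * L / n)) ≤
      (1 + 80 * ∑ j ∈ Finset.Icc 1 n, ENNReal.ofReal ((j : ℝ) ^ (-(3 / 2) : ℝ)) *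
            ∑ l ∈ Finset.Icc 1 j, mixingCoeff 𝒞 X P (k * l)) *
          ENNReal.ofReal (√(2 * L / (n : ℝ))) := by
    rw [ENNReal.ofReal_mul (by positivity)]
    gcongr
    have h1 : ENNReal.ofReal (1 + 80 * (T : ℝ)) = 1 + 80 * (T : ℝ≥0∞) := by
      rw [← ENNReal.ofReal_coe_nnreal (p := T), ENNReal.ofReal_add zero_le_one (by positivity),
        ENNReal.ofReal_mul (by norm_num)]
      simp
    rw [h1, hT, ENNReal.ofNNReal_finsetSum]
    gcongr with j hj
    rw [ENNReal.coe_mul, ENNReal.ofNNReal_finsetSum, sum_Icc_one_eq_sum_range]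
    gcongr with l hl
    · rw [← ENNReal.ofReal_coe_nnreal]
      push_cast
      exact le_rfl
    · rw [coe_truncatedCoeff]
      exact min_le_left _ _
  have hcover : Set.univ ⊆ S ∪ B := by
    intro ω _
    by_contra hω
    rw [Set.mem_union, not_or] at hω
    obtain ⟨hωS, hωB⟩ := hω
    refine hωS (le_trans (ENNReal.ofReal_le_ofReal ?_) hradius)
    have hlt : |∑ i ∈ Finset.range n, ((X (k * (i + 1)) ω : ℝ) - μ)| <
      ((NNReal.sqrt n * (1 + 8 * T) : ℝ≥0) : ℝ) * √(2 * L) := not_le.1 hωB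
    have hmean : (n : ℝ)⁻¹ * (∑ t ∈ Finset.Icc 1 n, (X (k * t) ω : ℝ)) - μ =
        (n : ℝ)⁻¹ * ∑ i ∈ Finset.range n, ((X (k * (i + 1)) ω : ℝ) - μ) := by
      rw [sum_Icc_one_eq_sum_range, Finset.sum_sub_distrib, Finset.sum_const, Finset.card_range,
        nsmul_eq_mul, mul_sub, inv_mul_cancel_left₀ hn0.ne']
    rw [hmean, abs_mul, abs_of_nonneg (by positivity : (0 : ℝ) ≤ (n : ℝ)⁻¹)]
    have hscale : (n : ℝ)⁻¹ * (√n * √(2 * L)) = √(2 * L / n) := by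
      rw [Real.sqrt_div (by positivity)]
      have := Real.sqrt_pos.2 hn0
      field_simp
      rw [Real.sq_sqrt hn0.le]
    calc (n : ℝ)⁻¹ * |∑ i ∈ Finset.range n, ((X (k * (i + 1)) ω : ℝ) - μ)|
        ≤ (n : ℝ)⁻¹ * (((NNReal.sqrt n * (1 + 8 * T) : ℝ≥0) : ℝ) * √(2 * L)) := by gcongr
      _ = (1 + 8 * T) * ((n : ℝ)⁻¹ * (√n * √(2 * L))) := by push_cast; ring
      _ = (1 + 8 * T) * √(2 * L / n) := by rw [hscale]
      _ ≤ (1 + 80 * T) * √(2 * L / n) := by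
        gcongr
        norm_num
  have hexp : 2 * Real.exp (-L) ≤ δ := by
    rw [Real.exp_neg, hL, Real.exp_log (by positivity), inv_div, mul_div_assoc', div_le_iff₀
      (by positivity)]
    nlinarith
  have htotal : (1 : ℝ) ≤ P.real S + P.real B :=
    calc (1 : ℝ) = P.real Set.univ := by simp
      _ ≤ P.real (S ∪ B) := measureReal_mono hcover
      _ ≤ _ := measureReal_union_le _ _
  linarith

end Mixing

end WeakMixing

theorem mainTheorem8 {Ω : Type*} [MeasurableSpace Ω] (P : Measure Ω) [IsProbabilityMeasure P]
    (𝒞 : WeakMixing.TestClass)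
    (hid : (fun x : unitInterval => (x : ℝ)) ∈ 𝒞.unitBall)
    (X : ℕ → Ω → unitInterval) (hX : ∀ t : ℕ, 1 ≤ t → Measurable (X t))
    (hstat : WeakMixing.IsWeaklyStationary X P)
    (hmix : WeakMixing.IsMixing 𝒞 X P)
    (μ : ℝ) (hμ : μ = ∫ ω, (X 1 ω : ℝ) ∂P)
    (n : ℕ) (hn : 1 ≤ n) (δ : ℝ) (hδ0 : 0 < δ) (hδ1 : δ < 1) :
    (1 - δ ≤ P.real {ω |
      ENNReal.ofReal |(n : ℝ)⁻¹ * (∑ t ∈ Finset.Icc 1 n, (X t ω : ℝ)) - μ| ≤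
        (1 + 80 * ∑ j ∈ Finset.Icc 1 n, ENNReal.ofReal ((j : ℝ) ^ (-(3 / 2) : ℝ)) *
            ∑ k ∈ Finset.Icc 1 j, WeakMixing.mixingCoeff 𝒞 X P k) *
          ENNReal.ofReal (Real.sqrt
            (2 * Real.log (4 * Real.sqrt (Real.exp 1) / δ) / (n : ℝ)))}) ∧
    (∀ k : ℕ, 1 ≤ k → 1 - δ ≤ P.real {ω |
      ENNReal.ofReal |(n : ℝ)⁻¹ * (∑ t ∈ Finset.Icc 1 n, (X (k * t) ω : ℝ)) - μ| ≤
        (1 + 80 * ∑ j ∈ Finset.Icc 1 n, ENNReal.ofReal ((j : ℝ) ^ (-(3 / 2) : ℝ)) *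
            ∑ l ∈ Finset.Icc 1 j, WeakMixing.mixingCoeff 𝒞 X P (k * l)) *
          ENNReal.ofReal (Real.sqrt
            (2 * Real.log (4 * Real.sqrt (Real.exp 1) / δ) / (n : ℝ)))}) := by
  have hmean : ∀ t : ℕ, 1 ≤ t → ∫ ω, (X t ω : ℝ) ∂P = μ := fun t ht =>
    (hstat.mean_eq t 1 ht le_rfl).trans hμ.symm
  refine ⟨?_, fun k hk => WeakMixing.deviation_gap_sample hid hX hmean hn hδ0 hδ1 hk⟩
  simpa only [one_mul] using WeakMixing.deviation_gap_sample hid hX hmean hn hδ0 hδ1 le_rfl
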